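/- Let $\mathbb T^1=\mathbb R/\mathbb Z$. For $\alpha\in\mathbb R$ and a continuous function $\mathcal C:\mathbb T^1\to\mathbb C$ consider the fibred quadratic polynomial $$P(\theta,z)=(\theta+\alpha,\;z^2+\mathcal C(\theta)),\qquad (\theta,z)\in\mathbb T^1\times\mathbb C .$$ An invariant curve of $P$ is a continuous $\gamma:\mathbb T^1\to\mathbb C$ with $P(\theta,\gamma(\theta))=(\theta+\alpha,\gamma(\theta+\alpha))$ for all $\theta$; it is attracting if its multiplicator $\kappa(\gamma)=\int_{\mathbb T^1}\log|2\gamma(\theta)|\,d\theta\in[-\infty,\infty)$ is negative. For an attracting invariant curve $\eta$ let $\Omega(\eta)\subset\mathbb T^1$ be the set of those $\theta$ for which the critical point $(\theta,0)$ is attracted by $\eta$, i.e. $|z_n-\eta(\theta+n\alpha)|\to0$ as $n\to\infty$, where $(\theta+n\alpha,z_n)=P^n(\theta,0)$. 1. If $\alpha$ is irrational and $\eta$ is an attracting invariant curve of $P$, then $\Omega(\eta)$ is open and non-empty. 2. If $\alpha$ is irrational and $\gamma_1,\gamma_2$ are attracting invariant curves of $P$ with $\gamma_1(\theta)\ne\gamma_2(\theta)$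 for all $\theta$, then $\Omega(\gamma_1)\cap\Omega(\gamma_2)=\emptyset$ and the set $\mathbb T^1\setminus(\Omega(\gamma_1)\cup\Omega(\gamma_2))$ is non-empty: some critical point is attracted by neither curve. 3. Such examples exist: there are an irrational $\alpha$, a continuous $\tilde{\mathcal C}:\mathbb T^1\to\mathbb C$ with $\tilde{\mathcal C}(t+\tfrac12)=\tilde{\mathcal C}(t)$, and continuous curves $\gamma_1,\gamma_2:\mathbb T^1\to\mathbb C$ with $\gamma_2(t)=\gamma_1(t+\tfrac12)\neq\gamma_1(t)$ for all $t$, which are both attracting invariant curves, with finite multiplicators, of $(t,z)\mapsto\left(t+\tfrac{\alpha+1}2,\;z^2+\tilde{\mathcal C}(t)\right)$. -/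

import Mathlib

open MeasureTheory Filter Topology

noncomputable section

/-- The polynomial `z ↦ z ^ 2 + c θ` on the fibre over `θ`; its critical point is `0`. -/
def fibrePoly (c : C(UnitAddCircle, ℂ)) (θ : UnitAddCircle) (z : ℂ) : ℂ :=
  z ^ 2 + c θ

/-- The fibred quadratic polynomial `(θ, z) ↦ (θ + α, z ^ 2 + c θ)` over the rotation by `α`. -/
def fibredQuad (α : UnitAddCircle) (c : C(UnitAddCircle, ℂ)) (p : UnitAddCircle × ℂ) :
    UnitAddCircle × ℂ :=
  (p.1 + α, fibrePoly c p.1 p.2)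

/-- The graph of the continuous function `γ` is invariant. -/
def IsInvariantCurve (α : UnitAddCircle) (c : C(UnitAddCircle, ℂ)) (γ : C(UnitAddCircle, ℂ)) :
    Prop :=
  ∀ θ, fibredQuad α c (θ, γ θ) = (θ + α, γ (θ + α))

/-- The multiplicator `∫ log |∂_z P_θ (γ θ)| dθ` with respect to the normalized Haar measure.
The integrand is bounded above but equals `-∞` where the derivative vanishes, so the integral is
taken in `[-∞, ∞)`, as (integral of the positive part) - (integral of the negative part);
the first integral is always finite. -/
def multiplicator (c : C(UnitAddCircle, ℂ)) (γ : C(UnitAddCircle, ℂ)) : EReal :=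
  ((∫⁻ θ : UnitAddCircle, (ENNReal.log ‖deriv (fibrePoly c θ) (γ θ)‖ₑ).toENNReal : ENNReal) :
      EReal) -
    ((∫⁻ θ : UnitAddCircle, (-ENNReal.log ‖deriv (fibrePoly c θ) (γ θ)‖ₑ).toENNReal : ENNReal) :
      EReal)

/-- An attracting invariant curve: invariant, with negative multiplicator. -/
def IsAttractingCurve (α : UnitAddCircle) (c : C(UnitAddCircle, ℂ)) (γ : C(UnitAddCircle, ℂ)) :
    Prop :=
  IsInvariantCurve α c γ ∧ multiplicator c γ < 0

/-- The point `p` is attracted by the curve `γ`: the distance, inside the fibre, from the `n`-th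
iterate of `p` to the curve tends to `0`. -/
def IsAttractedBy (α : UnitAddCircle) (c : C(UnitAddCircle, ℂ)) (γ : C(UnitAddCircle, ℂ))
    (p : UnitAddCircle × ℂ) : Prop :=
  Tendsto (fun n : ℕ => dist ((fibredQuad α c)^[n] p).2 (γ ((fibredQuad α c)^[n] p).1))
    atTop (𝓝 0)

/-- The set of those `θ` whose critical point `(θ, 0)` is attracted by `γ`. -/
def criticalBasin (α : UnitAddCircle) (c : C(UnitAddCircle, ℂ)) (γ : C(UnitAddCircle, ℂ)) :
    Set UnitAddCircle :=
  {θ | IsAttractedBy α c γ (θ, 0)}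

end

noncomputable section

/-! Equidistribution makes the Birkhoff sums of `log (2‖γ‖ + δ)` tend to `-∞` uniformly, where `δ`
absorbs both the zeros of `γ` and the quadratic error. Hence a uniform tube around an attracting
curve is attracted (`exists_attracting_tube`), and the basin is open. Non-emptiness is the fibred
form of Fatou's argument: if no critical point were attracted, inverse branches of all iterates
would exist on discs of fixed radius (`exists_inverse_branch`). They take values in the bounded
basin, so Cauchy bounds their derivatives, yet these are inverses of products tending to `0`. Two
disjoint non-empty open basins cannot cover the connected circle. For the example take `γ₁ = e + o`,
`γ₂ = e - o` with `e` even and `o` odd under the half turn. The forcing is even iff `2 e o = o(· +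
β)`. Then `2 γ₁ = (o(· + β) / o) (1 + L)` with `L = 2 o² / o(· + β)`, so both multiplicators equal
`∫ log ‖1 + L‖`. Any `L` homotopic to `toCircle` off `0` can be realised up to solving a
cohomological equation; an ellipse makes the integral negative. -/

/-! ### Uniform equidistribution of irrational rotations. -/

theorem zsmul_coe_ne_zero_of_irrational {α : ℝ} (hα : Irrational α) {n : ℤ} (hn : n ≠ 0) :
    n • (α : UnitAddCircle) ≠ 0 := by
  intro h
  rw [← AddCircle.coe_zsmul, AddCircle.coe_eq_zero_iff] at h
  obtain ⟨m, hm⟩ := h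
  rw [zsmul_eq_mul, zsmul_eq_mul, mul_one] at hm
  refine hα ⟨(m : ℚ) / n, ?_⟩
  have : (n : ℝ) ≠ 0 := by exact_mod_cast hn
  push_cast
  field_simp
  linarith

theorem integral_fourier_eq_zero {n : ℤ} (hn : n ≠ 0) :
    ∫ θ : UnitAddCircle, (fourier n θ : ℂ) = 0 :=
  integral_eq_zero_of_add_right_eq_neg (fourier_add_half_inv_index hn one_pos)

theorem ContinuousMap.integrable_unitAddCircle {E : Type*} [NormedAddCommGroup E]
    (f : C(UnitAddCircle, E)) : Integrable f (volume : Measure UnitAddCircle) :=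
  (map_continuous f).integrable_of_hasCompactSupport (HasCompactSupport.of_compactSpace f)

/-- Uniform convergence of Birkhoff sums over an irrational rotation, in an additive form. -/
theorem exists_norm_birkhoff_sub_le {α : UnitAddCircle} (hα : ∀ n : ℤ, n ≠ 0 → n • α ≠ 0)
    (f : C(UnitAddCircle, ℂ)) {ε : ℝ} (hε : 0 < ε) :
    ∃ B : ℝ, ∀ (n : ℕ) (θ : UnitAddCircle),
      ‖∑ k ∈ Finset.range n, f (θ + k • α) - n * ∫ t, f t‖ ≤ B + ε * n := by
  have hspan : ∀ g ∈ Submodule.span ℂ (Set.range (@fourier 1)), ∃ B : ℝ,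
      ∀ (n : ℕ) (θ : UnitAddCircle),
        ‖∑ k ∈ Finset.range n, g (θ + k • α) - n * ∫ t, g t‖ ≤ B := by
    intro g hg
    induction hg using Submodule.span_induction with
    | mem x hx =>
      obtain ⟨m, rfl⟩ := hx
      by_cases hm : m = 0
      · refine ⟨0, fun n θ => ?_⟩
        subst hm
        simp [measureReal_def]
      -- Along the orbit a non-trivial character is a geometric progression, so its sums are
      -- bounded.
      · refine ⟨2 / ‖fourier m α - 1‖, fun n θ => ?_⟩
        have hne : (fourier m α : ℂ) ≠ 1 := by
          intro h
          rw [fourier_apply, ← Circle.coe_one, Circle.coe_inj, ← AddCircle.toCircle_zero] at h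
          exact hα m hm (AddCircle.injective_toCircle one_ne_zero h)
        have hk : ∀ k : ℕ, fourier m (θ + k • α) = fourier m θ * (fourier m α) ^ k := by
          intro k
          simp only [fourier_apply, smul_add, AddCircle.toCircle_add, Circle.coe_mul]
          rw [smul_comm, AddCircle.toCircle_nsmul, Circle.coe_pow]
        rw [integral_fourier_eq_zero hm, Finset.sum_congr rfl fun k _ => hk k, ← Finset.mul_sum,
          geom_sum_eq hne, mul_zero, sub_zero, norm_mul, norm_div]
        have h1 : ‖fourier m θ‖ = 1 := Circle.norm_coe _
        have h2 : ‖fourier m α‖ = 1 := Circle.norm_coe _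
        rw [h1, one_mul]
        gcongr
        refine (norm_sub_le _ _).trans ?_
        rw [norm_pow, h2]
        norm_num
    | zero => exact ⟨0, fun n θ => by simp⟩
    | add x y _ _ hx hy =>
      obtain ⟨A, hA⟩ := hx
      obtain ⟨B, hB⟩ := hy
      refine ⟨A + B, fun n θ => ?_⟩
      have : ∫ t, (x + y) t = (∫ t, x t) + ∫ t, y t :=
        integral_add x.integrable_unitAddCircle y.integrable_unitAddCircle
      rw [this]
      refine le_trans (le_of_eq ?_) ((norm_add_le _ _).trans (add_le_add (hA n θ) (hB n θ)))
      congr 1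
      simp only [ContinuousMap.add_apply, Finset.sum_add_distrib]
      ring
    | smul a x _ hx =>
      obtain ⟨A, hA⟩ := hx
      refine ⟨‖a‖ * A, fun n θ => ?_⟩
      have : ∫ t, (a • x) t = a * ∫ t, x t := integral_const_mul a _
      rw [this]
      refine le_trans (le_of_eq ?_) (mul_le_mul_of_nonneg_left (hA n θ) (norm_nonneg a))
      rw [← norm_mul]
      congr 1
      simp only [ContinuousMap.smul_apply, smul_eq_mul, ← Finset.mul_sum]
      ring
  have hcl : f ∈ closure (Submodule.span ℂ (Set.range (@fourier 1)) : Set C(UnitAddCircle, ℂ)) := by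
    rw [← Submodule.topologicalClosure_coe, span_fourier_closure_eq_top]
    trivial
  -- The error `ε / 2` is paid twice: in the Birkhoff sum and in the mean.
  obtain ⟨g, hg, hfg⟩ := Metric.mem_closure_iff.1 hcl (ε / 2) (by positivity)
  obtain ⟨B, hB⟩ := hspan g hg
  refine ⟨B, fun n θ => ?_⟩
  have hpt : ∀ t, ‖f t - g t‖ ≤ ε / 2 := fun t => by
    rw [← dist_eq_norm]
    exact (ContinuousMap.dist_apply_le_dist t).trans hfg.le
  have h1 : ‖∑ k ∈ Finset.range n, (f (θ + k • α) - g (θ + k • α))‖ ≤ n * (ε / 2) := by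
    refine (norm_sum_le_of_le _ fun k _ => hpt _).trans ?_
    rw [Finset.sum_const, Finset.card_range, nsmul_eq_mul]
  have h2 : ‖∫ t, (f t - g t)‖ ≤ ε / 2 := by
    refine (norm_integral_le_of_norm_le_const (ae_of_all _ hpt)).trans ?_
    simp [measureReal_def]
  rw [integral_sub f.integrable_unitAddCircle g.integrable_unitAddCircle] at h2
  rw [Finset.sum_sub_distrib] at h1
  have h3 : ‖(n : ℂ) * ((∫ t, f t) - ∫ t, g t)‖ ≤ n * (ε / 2) := by
    rw [norm_mul, Complex.norm_natCast]
    gcongr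
  calc ‖∑ k ∈ Finset.range n, f (θ + k • α) - n * ∫ t, f t‖
      = ‖(∑ k ∈ Finset.range n, f (θ + k • α) - ∑ k ∈ Finset.range n, g (θ + k • α)) +
          (∑ k ∈ Finset.range n, g (θ + k • α) - n * ∫ t, g t) -
          n * ((∫ t, f t) - ∫ t, g t)‖ := by congr 1; ring
    _ ≤ n * (ε / 2) + B + n * (ε / 2) :=
      (norm_sub_le _ _).trans (add_le_add ((norm_add_le _ _).trans (add_le_add h1 (hB n θ))) h3)
    _ = B + ε * n := by ring

/-- If the mean of `f` is negative, then its Birkhoff sums over an irrational rotation go to `-∞`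
linearly and uniformly. -/
theorem exists_birkhoff_le_of_integral_neg {α : UnitAddCircle} (hα : ∀ n : ℤ, n ≠ 0 → n • α ≠ 0)
    (f : C(UnitAddCircle, ℝ)) (hf : ∫ t, f t < 0) :
    ∃ B : ℝ, ∃ a > 0, ∀ (n : ℕ) (θ : UnitAddCircle),
      ∑ k ∈ Finset.range n, f (θ + k • α) ≤ B - a * n := by
  set m := ∫ t, f t with hm
  obtain ⟨B, hB⟩ := exists_norm_birkhoff_sub_le hα
    (⟨fun t => (f t : ℂ), by fun_prop⟩ : C(UnitAddCircle, ℂ)) (ε := -m / 2) (by linarith)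
  refine ⟨B, -m / 2, by linarith, fun n θ => ?_⟩
  have h := hB n θ
  simp only [ContinuousMap.coe_mk, integral_complex_ofReal] at h
  rw [← hm] at h
  have h' := (Complex.re_le_norm _).trans h
  rw [← Complex.ofReal_sum, ← Complex.ofReal_natCast, ← Complex.ofReal_mul, ← Complex.ofReal_sub,
    Complex.ofReal_re] at h'
  linarith

/-! ### Holomorphic square roots. -/

/-- Square roots of non-vanishing holomorphic functions on a disc. -/
theorem exists_sq_eq_of_differentiableOn_ball {g : ℂ → ℂ} {z s : ℂ} {r : ℝ} (hr : 0 < r)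
    (hg : DifferentiableOn ℂ g (Metric.ball z r)) (h0 : ∀ w ∈ Metric.ball z r, g w ≠ 0)
    (hs : s ^ 2 = g z) :
    ∃ f : ℂ → ℂ, DifferentiableOn ℂ f (Metric.ball z r) ∧ f z = s ∧
      ∀ w ∈ Metric.ball z r, f w ^ 2 = g w := by
  -- `H` is a primitive of `g' / g`, i.e. a logarithm of `g` up to a constant.
  obtain ⟨H, hH⟩ := ((hg.deriv Metric.isOpen_ball).div hg h0).isExactOn_ball
  have hz : z ∈ Metric.ball z r := Metric.mem_ball_self hr
  have hHd : DifferentiableOn ℂ H (Metric.ball z r) := fun w hw =>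
    (hH w hw).differentiableAt.differentiableWithinAt
  have hconst : ∀ w ∈ Metric.ball z r, g w * Complex.exp (-H w) = g z * Complex.exp (-H z) := by
    intro w hw
    have hder : ∀ w ∈ Metric.ball z r,
        HasDerivAt (fun w => g w * Complex.exp (-H w)) 0 w := by
      intro w hw
      have h1 := (hg.differentiableAt (Metric.isOpen_ball.mem_nhds hw)).hasDerivAt
      have h2 := (hH w hw).fun_neg.cexp
      convert! h1.mul h2 using 1
      have := h0 w hw
      simp only [Pi.div_apply]
      field_simp
      ring
    exact Metric.isOpen_ball.is_const_of_deriv_eq_zero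
      (convex_ball z r).isPreconnected
      (fun w hw => (hder w hw).differentiableAt.differentiableWithinAt)
      (fun w hw => (hder w hw).deriv) hw hz
  refine ⟨fun w => s * Complex.exp ((H w - H z) / 2),
    (((hHd.sub_const _).div_const _).cexp).const_mul s, by simp, fun w hw => ?_⟩
  rw [mul_pow, hs, ← Complex.exp_nat_mul]
  have h := hconst w hw
  rw [Complex.exp_neg, Complex.exp_neg] at h
  have e1 := Complex.exp_ne_zero (H w)
  have e2 := Complex.exp_ne_zero (H z)
  rw [show ((2 : ℕ) : ℂ) * ((H w - H z) / 2) = H w - H z by push_cast; ring, Complex.exp_sub]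
  field_simp at h ⊢
  exact h.symm

/-! ### The multiplicator and uniform contraction along the curve. -/

theorem toENNReal_log_ofReal {x : ℝ} (hx : 0 < x) :
    (ENNReal.log (ENNReal.ofReal x)).toENNReal = ENNReal.ofReal (Real.log x) := by
  rw [ENNReal.log_ofReal_of_pos hx, EReal.toENNReal_of_ne_top (EReal.coe_ne_top _), EReal.toReal_coe]

theorem toENNReal_neg_log_ofReal {x : ℝ} (hx : 0 < x) :
    (-ENNReal.log (ENNReal.ofReal x)).toENNReal = ENNReal.ofReal (-Real.log x) := by
  rw [ENNReal.log_ofReal_of_pos hx, ← EReal.coe_neg,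
    EReal.toENNReal_of_ne_top (EReal.coe_ne_top _), EReal.toReal_coe]

theorem enorm_deriv_fibrePoly (c : C(UnitAddCircle, ℂ)) (θ : UnitAddCircle) (z : ℂ) :
    ‖deriv (fibrePoly c θ) z‖ₑ = ENNReal.ofReal (2 * ‖z‖) := by
  have h : HasDerivAt (fibrePoly c θ) (2 * z) z := by
    convert! (hasDerivAt_pow 2 z).add_const (c θ) using 1
    simp
  rw [h.deriv, ← ofReal_norm, norm_mul]
  simp

theorem multiplicator_eq (c γ : C(UnitAddCircle, ℂ)) :
    multiplicator c γ =
      ((∫⁻ θ, (ENNReal.log (ENNReal.ofReal (2 * ‖γ θ‖))).toENNReal : ENNReal) : EReal) -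
      ((∫⁻ θ, (-ENNReal.log (ENNReal.ofReal (2 * ‖γ θ‖))).toENNReal : ENNReal) : EReal) := by
  simp only [multiplicator, enorm_deriv_fibrePoly]

theorem continuous_log_of_pos {g : UnitAddCircle → ℝ} (hg : Continuous g) (h : ∀ θ, 0 < g θ) :
    Continuous fun θ => Real.log (g θ) :=
  hg.log fun θ => (h θ).ne'

theorem integrable_of_continuous {g : UnitAddCircle → ℝ} (hg : Continuous g) :
    Integrable g :=
  ContinuousMap.integrable_unitAddCircle ⟨g, hg⟩

/-- For a non-vanishing curve the multiplicator is an ordinary integral. -/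
theorem multiplicator_eq_integral (c γ : C(UnitAddCircle, ℂ)) (h : ∀ θ, γ θ ≠ 0) :
    multiplicator c γ = ((∫ θ, Real.log (2 * ‖γ θ‖) : ℝ) : EReal) := by
  have hpos : ∀ θ, 0 < 2 * ‖γ θ‖ := fun θ => by have := norm_pos_iff.2 (h θ); positivity
  have hint := integrable_of_continuous
    (continuous_log_of_pos (g := fun θ => 2 * ‖γ θ‖) (by fun_prop) hpos)
  rw [multiplicator_eq, integral_eq_lintegral_pos_part_sub_lintegral_neg_part hint, EReal.coe_sub]
  simp only [toENNReal_log_ofReal (hpos _), toENNReal_neg_log_ofReal (hpos _)]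
  have hneg : ∫⁻ θ, ENNReal.ofReal (-Real.log (2 * ‖γ θ‖)) ≠ ⊤ := hint.neg.lintegral_lt_top.ne
  rw [EReal.coe_ennreal_toReal hint.lintegral_lt_top.ne, EReal.coe_ennreal_toReal hneg]

/-- Let `δ` decrease to `0`: dominated convergence handles the positive part of the logarithm,
monotone convergence the negative part, whose limit may be infinite. The gain is a continuous
integrand even where `γ` vanishes. -/
theorem exists_integral_log_add_neg {c γ : C(UnitAddCircle, ℂ)} (h : multiplicator c γ < 0) :
    ∃ δ > 0, ∫ θ, Real.log (2 * ‖γ θ‖ + δ) < 0 := by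
  obtain ⟨u, hanti, hupos, hu⟩ := exists_seq_strictAnti_tendsto' (show (0 : ℝ) < 1 from one_pos)
  have hpos : ∀ n θ, 0 < 2 * ‖γ θ‖ + u n := fun n θ => by have := (hupos n).1; positivity
  have hlim : ∀ θ, Tendsto (fun n => ENNReal.log (ENNReal.ofReal (2 * ‖γ θ‖ + u n))) atTop
      (𝓝 (ENNReal.log (ENNReal.ofReal (2 * ‖γ θ‖)))) := fun θ => by
    refine (ENNReal.continuous_log.comp ENNReal.continuous_ofReal).continuousAt.tendsto.comp ?_
    simpa using hu.const_add (2 * ‖γ θ‖)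
  have hcont : ∀ n, Continuous fun θ => Real.log (2 * ‖γ θ‖ + u n) := fun n =>
    continuous_log_of_pos (by fun_prop) (hpos n)
  have hP : Tendsto (fun n => ∫⁻ θ, ENNReal.ofReal (Real.log (2 * ‖γ θ‖ + u n))) atTop
      (𝓝 (∫⁻ θ, (ENNReal.log (ENNReal.ofReal (2 * ‖γ θ‖))).toENNReal)) := by
    refine tendsto_lintegral_of_dominated_convergence
      (fun _ => ENNReal.ofReal (Real.log (2 * ‖γ‖ + 1)))
      (fun n => (hcont n).measurable.ennreal_ofReal) (fun n => ae_of_all _ fun θ => ?_) ?_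
      (ae_of_all _ fun θ => ?_)
    · refine ENNReal.ofReal_le_ofReal (Real.log_le_log (hpos n θ) ?_)
      have := γ.norm_coe_le_norm θ
      linarith [(hupos n).2]
    · simp
    · simp only [← toENNReal_log_ofReal (hpos _ _)]
      exact (EReal.continuous_toENNReal.tendsto _).comp (hlim θ)
  have hN : Tendsto (fun n => ∫⁻ θ, ENNReal.ofReal (-Real.log (2 * ‖γ θ‖ + u n))) atTop
      (𝓝 (∫⁻ θ, (-ENNReal.log (ENNReal.ofReal (2 * ‖γ θ‖))).toENNReal)) := by
    refine lintegral_tendsto_of_tendsto_of_monotone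
      (fun n => (hcont n).neg.measurable.ennreal_ofReal.aemeasurable)
      (ae_of_all _ fun θ m n hmn => ?_) (ae_of_all _ fun θ => ?_)
    · have := hanti.antitone hmn
      refine ENNReal.ofReal_le_ofReal (neg_le_neg (Real.log_le_log (hpos n θ) (by linarith)))
    · simp only [← toENNReal_neg_log_ofReal (hpos _ _)]
      exact ((EReal.continuous_toENNReal.comp continuous_neg).tendsto _).comp (hlim θ)
  have hlt : ∫⁻ θ, (ENNReal.log (ENNReal.ofReal (2 * ‖γ θ‖))).toENNReal <
      ∫⁻ θ, (-ENNReal.log (ENNReal.ofReal (2 * ‖γ θ‖))).toENNReal := by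
    rw [multiplicator_eq] at h
    by_contra hle
    rw [not_lt] at hle
    refine absurd h (not_lt.2 ?_)
    have hfin : ∫⁻ θ, (ENNReal.log (ENNReal.ofReal (2 * ‖γ θ‖))).toENNReal ≠ ⊤ := by
      refine ((lintegral_mono fun θ => ?_).trans_lt (lintegral_const_lt_top (α := UnitAddCircle)
        (μ := volume) (c := ENNReal.ofReal (Real.log (2 * ‖γ‖ + 1))) ENNReal.ofReal_ne_top)).ne
      have h1 : (0 : ℝ) < 2 * ‖γ‖ + 1 := by positivity
      simp only [← toENNReal_log_ofReal h1]
      refine EReal.toENNReal_le_toENNReal (ENNReal.log_le_log (ENNReal.ofReal_le_ofReal ?_))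
      linarith [γ.norm_coe_le_norm θ]
    refine (EReal.sub_nonneg (.inl ?_) (.inl ?_)).2 (by exact_mod_cast hle)
    · rwa [Ne, EReal.coe_ennreal_eq_top_iff]
    · exact EReal.coe_ennreal_ne_bot _
  obtain ⟨n, hn⟩ := (hP.eventually_lt hN hlt).exists
  refine ⟨u n, (hupos n).1, ?_⟩
  have hint := integrable_of_continuous (hcont n)
  rw [integral_eq_lintegral_pos_part_sub_lintegral_neg_part hint, sub_neg]
  have hfin : ∫⁻ θ, ENNReal.ofReal (-Real.log (2 * ‖γ θ‖ + u n)) ≠ ⊤ :=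
    hint.neg.lintegral_lt_top.ne
  exact (ENNReal.toReal_lt_toReal hn.ne_top hfin).2 hn

theorem exists_prod_le_of_multiplicator_neg {α : UnitAddCircle} (hα : ∀ n : ℤ, n ≠ 0 → n • α ≠ 0)
    {c γ : C(UnitAddCircle, ℂ)} (h : multiplicator c γ < 0) :
    ∃ δ > 0, ∃ C, ∃ r : ℝ, 0 ≤ r ∧ r < 1 ∧ ∀ (n : ℕ) (θ : UnitAddCircle),
      ∏ k ∈ Finset.range n, (2 * ‖γ (θ + k • α)‖ + δ) ≤ C * r ^ n := by
  obtain ⟨δ, hδ, hneg⟩ := exists_integral_log_add_neg h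
  have hpos : ∀ θ, 0 < 2 * ‖γ θ‖ + δ := fun θ => by positivity
  obtain ⟨B, a, ha, hB⟩ := exists_birkhoff_le_of_integral_neg hα
    ⟨fun θ => Real.log (2 * ‖γ θ‖ + δ), continuous_log_of_pos (by fun_prop) hpos⟩ hneg
  refine ⟨δ, hδ, Real.exp B, Real.exp (-a), (Real.exp_pos _).le, by simpa using ha,
    fun n θ => ?_⟩
  rw [← Real.exp_nat_mul, ← Real.exp_add]
  refine le_trans (le_of_eq ?_) (Real.exp_le_exp.2 ((hB n θ).trans_eq (by ring)))
  rw [Real.exp_sum]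
  exact Finset.prod_congr rfl fun k _ => (Real.exp_log (hpos _)).symm

/-! ### The attracting tube and openness of the basin. -/

theorem fibredQuad_iterate_fst (α : UnitAddCircle) (c : C(UnitAddCircle, ℂ)) (n : ℕ)
    (p : UnitAddCircle × ℂ) : ((fibredQuad α c)^[n] p).1 = p.1 + n • α := by
  induction n with
  | zero => simp
  | succ n ih =>
    rw [Function.iterate_succ_apply', fibredQuad, ih, add_assoc, succ_nsmul]

theorem continuous_fibredQuad (α : UnitAddCircle) (c : C(UnitAddCircle, ℂ)) :
    Continuous (fibredQuad α c) := by
  unfold fibredQuad fibrePoly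
  fun_prop

theorem isAttractedBy_iterate_iff {α : UnitAddCircle} {c γ : C(UnitAddCircle, ℂ)}
    {p : UnitAddCircle × ℂ} (m : ℕ) :
    IsAttractedBy α c γ ((fibredQuad α c)^[m] p) ↔ IsAttractedBy α c γ p := by
  unfold IsAttractedBy
  rw [← tendsto_add_atTop_iff_nat (f := fun n => dist ((fibredQuad α c)^[n] p).2
    (γ ((fibredQuad α c)^[n] p).1)) m]
  simp only [Function.iterate_add_apply]

theorem IsInvariantCurve.apply_add {α : UnitAddCircle} {c γ : C(UnitAddCircle, ℂ)}
    (h : IsInvariantCurve α c γ) (θ : UnitAddCircle) : γ (θ + α) = γ θ ^ 2 + c θ :=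
  (congrArg Prod.snd (h θ)).symm

/-- Points of a sufficiently thin tube around an attracting curve are attracted. -/
theorem exists_attracting_tube {α : UnitAddCircle} (hα : ∀ n : ℤ, n ≠ 0 → n • α ≠ 0)
    {c γ : C(UnitAddCircle, ℂ)} (h : IsAttractingCurve α c γ) :
    ∃ ρ > 0, ∀ p : UnitAddCircle × ℂ, dist p.2 (γ p.1) < ρ → IsAttractedBy α c γ p := by
  obtain ⟨δ, hδ, C, r, hr0, hr1, hprod⟩ := exists_prod_le_of_multiplicator_neg hα h.2
  have hC : 1 ≤ C := by simpa using hprod 0 0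
  have hC0 : 0 < C := one_pos.trans_le hC
  -- `C` bounds every partial product, so an orbit starting this close stays within `δ` of the
  -- curve, where the factor `2‖γ‖ + δ` is valid.
  refine ⟨δ / C, by positivity, fun p hp => ?_⟩
  have hle : ∀ n, (∏ k ∈ Finset.range n, (2 * ‖γ (p.1 + k • α)‖ + δ)) * dist p.2 (γ p.1) ≤
      δ * r ^ n := fun n => by
    calc _ ≤ (C * r ^ n) * (δ / C) := by
          gcongr
          exact hprod n p.1
      _ = δ * r ^ n := by field_simp
  have key : ∀ n, dist ((fibredQuad α c)^[n] p).2 (γ ((fibredQuad α c)^[n] p).1) ≤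
      (∏ k ∈ Finset.range n, (2 * ‖γ (p.1 + k • α)‖ + δ)) * dist p.2 (γ p.1) := by
    intro n
    induction n with
    | zero => simp
    | succ n ih =>
      have hδn := (ih.trans (hle n)).trans (mul_le_of_le_one_right hδ.le (pow_le_one₀ hr0 hr1.le))
      rw [Function.iterate_succ_apply', Finset.prod_range_succ]
      have hfst := fibredQuad_iterate_fst α c n p
      set q := (fibredQuad α c)^[n] p
      rw [← hfst]
      simp only [fibredQuad, fibrePoly, h.1.apply_add]
      rw [dist_eq_norm, dist_eq_norm] at *
      calc ‖q.2 ^ 2 + c q.1 - (γ q.1 ^ 2 + c q.1)‖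
          = ‖2 * γ q.1 + (q.2 - γ q.1)‖ * ‖q.2 - γ q.1‖ := by
            rw [← norm_mul]; congr 1; ring
        _ ≤ (2 * ‖γ q.1‖ + δ) * ‖q.2 - γ q.1‖ := by
            gcongr
            refine (norm_add_le _ _).trans (add_le_add (by simp) hδn)
        _ ≤ (2 * ‖γ q.1‖ + δ) *
              ((∏ k ∈ Finset.range n, (2 * ‖γ (p.1 + k • α)‖ + δ)) * ‖p.2 - γ p.1‖) := by
            gcongr
        _ = _ := by ring
  refine squeeze_zero (fun _ => dist_nonneg) (fun n => (key n).trans (hle n)) ?_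
  simpa using (tendsto_pow_atTop_nhds_zero_of_lt_one hr0 hr1).const_mul δ

theorem isOpen_criticalBasin {α : UnitAddCircle} (hα : ∀ n : ℤ, n ≠ 0 → n • α ≠ 0)
    {c γ : C(UnitAddCircle, ℂ)} (h : IsAttractingCurve α c γ) : IsOpen (criticalBasin α c γ) := by
  obtain ⟨ρ, hρ, htube⟩ := exists_attracting_tube hα h
  -- A point is attracted iff its orbit ever enters the tube, an open condition at each time.
  have : criticalBasin α c γ = ⋃ n : ℕ, {θ | dist ((fibredQuad α c)^[n] (θ, 0)).2
      (γ ((fibredQuad α c)^[n] (θ, 0)).1) < ρ} := by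
    ext θ
    simp only [Set.mem_iUnion, Set.mem_ofPred_eq]
    constructor
    · intro hθ
      exact (Tendsto.eventually_lt_const hρ hθ).exists
    · rintro ⟨n, hn⟩
      exact (isAttractedBy_iterate_iff n).1 (htube _ hn)
  rw [this]
  refine isOpen_iUnion fun n => isOpen_lt ?_ continuous_const
  have hc : Continuous fun θ : UnitAddCircle => (fibredQuad α c)^[n] (θ, 0) :=
    ((continuous_fibredQuad α c).iterate n).comp (by fun_prop)
  fun_prop

/-! ### Inverse branches and non-emptiness of the basin. -/

/-- Points attracted by some curve stay in a compact part of the fibres. -/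
theorem exists_norm_le_of_isAttractedBy (α : UnitAddCircle) (c γ : C(UnitAddCircle, ℂ)) :
    ∃ R, ∀ p, IsAttractedBy α c γ p → ‖p.2‖ ≤ R := by
  set M := ‖c‖ + ‖γ‖ with hM
  -- `M + 2` is an escape radius: beyond it the squaring outweighs `c`, and the curve lies at
  -- distance more than `1`.
  refine ⟨M + 2, fun p hp => ?_⟩
  by_contra! hlt
  have hesc : ∀ n, M + 2 < ‖((fibredQuad α c)^[n] p).2‖ := by
    intro n
    induction n with
    | zero => exact hlt
    | succ n ih =>
      rw [Function.iterate_succ_apply']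
      set q := (fibredQuad α c)^[n] p
      have h1 : ‖q.2‖ ^ 2 - ‖c q.1‖ ≤ ‖q.2 ^ 2 + c q.1‖ := by
        rw [← norm_pow]
        exact norm_sub_le_norm_add _ _
      have h2 := c.norm_coe_le_norm q.1
      have h3 : 0 ≤ ‖γ‖ := norm_nonneg _
      have h4 : 0 ≤ ‖c‖ := norm_nonneg _
      show M + 2 < ‖q.2 ^ 2 + c q.1‖
      nlinarith
  obtain ⟨n, hn⟩ := (Tendsto.eventually_lt_const (show (0 : ℝ) < 1 from one_pos) hp).exists
  have h1 := hesc n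
  set q := (fibredQuad α c)^[n] p
  rw [dist_eq_norm] at hn
  have h2 := norm_sub_norm_le q.2 (γ q.1)
  have h3 := γ.norm_coe_le_norm q.1
  have h4 : 0 ≤ ‖c‖ := norm_nonneg _
  linarith

/-- As long as no critical point is attracted, the inverse branches of the iterates along an
invariant curve extend to a tube of attracted points. -/
theorem exists_inverse_branch {α : UnitAddCircle} {c γ : C(UnitAddCircle, ℂ)}
    (h : IsInvariantCurve α c γ) {ρ : ℝ} (hρ : 0 < ρ)
    (htube : ∀ p : UnitAddCircle × ℂ, dist p.2 (γ p.1) < ρ → IsAttractedBy α c γ p)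
    (hcrit : ∀ θ, ¬ IsAttractedBy α c γ (θ, 0)) (n : ℕ) (θ : UnitAddCircle) :
    ∃ f : ℂ → ℂ, DifferentiableOn ℂ f (Metric.ball (γ (θ + n • α)) ρ) ∧
      (∀ w ∈ Metric.ball (γ (θ + n • α)) ρ, IsAttractedBy α c γ (θ, f w)) ∧
      f (γ (θ + n • α)) = γ θ ∧
      deriv f (γ (θ + n • α)) * ∏ k ∈ Finset.range n, (2 * γ (θ + k • α)) = 1 := by
  induction n generalizing θ with
  | zero =>
    refine ⟨id, differentiableOn_id, fun w hw => htube _ (by simpa using! hw), by simp, by simp⟩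
  | succ n ih =>
    have hθ : θ + α + n • α = θ + (n + 1) • α := by rw [succ_nsmul']; abel
    obtain ⟨g, hg, hgw, hgc, hgd⟩ := ih (θ + α)
    rw [hθ] at hg hgw hgc hgd
    set z := γ (θ + (n + 1) • α) with hz
    have hstep : ∀ w : ℂ, IsAttractedBy α c γ (θ, w) ↔ IsAttractedBy α c γ (θ + α, w ^ 2 + c θ) :=
      fun w => (isAttractedBy_iterate_iff (p := (θ, w)) 1).symm
    -- A zero of `g - c θ` would make the image of `(θ, 0)` an attracted point, hence `(θ, 0)`
    -- attracted too. The root `γ θ` selects the branch following the curve.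
    obtain ⟨f, hf, hfz, hfsq⟩ := exists_sq_eq_of_differentiableOn_ball (s := γ θ) hρ
      (hg.sub_const (c θ)) (fun w hw h0 => hcrit θ ((hstep 0).2 (by
        have := hgw w hw
        rwa [sub_eq_zero.1 h0, show c θ = 0 ^ 2 + c θ by ring] at this)))
      (by rw [hgc, h.apply_add]; ring)
    refine ⟨f, hf, fun w hw => (hstep _).2 ?_, hfz, ?_⟩
    · rw [hfsq w hw, sub_add_cancel]
      exact hgw w hw
    · have hmem : Metric.ball z ρ ∈ 𝓝 z := Metric.ball_mem_nhds z hρ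
      have hfd := (hf.differentiableAt hmem).hasDerivAt
      have hsq : HasDerivAt g (2 * f z * deriv f z) z := by
        have h1 : HasDerivAt (fun w => f w ^ 2 + c θ) (2 * f z * deriv f z) z := by
          simpa using! (hfd.fun_pow 2).add_const (c θ)
        refine h1.congr_of_eventuallyEq ?_
        filter_upwards [hmem] with w hw
        rw [hfsq w hw, sub_add_cancel]
      rw [hsq.deriv, hfz] at hgd
      rw [Finset.prod_range_succ', ← hgd]
      simp only [zero_smul, add_zero, succ_nsmul', add_assoc]
      ring

/-- Otherwise Cauchy's estimate bounds the derivatives of the inverse branches along one orbit,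
while the forward multipliers decay exponentially; their product is `1`. -/
theorem criticalBasin_nonempty {α : UnitAddCircle} (hα : ∀ n : ℤ, n ≠ 0 → n • α ≠ 0)
    {c γ : C(UnitAddCircle, ℂ)} (h : IsAttractingCurve α c γ) :
    (criticalBasin α c γ).Nonempty := by
  by_contra hempty
  have hcrit : ∀ θ, ¬ IsAttractedBy α c γ (θ, 0) := fun θ hθ => hempty ⟨θ, hθ⟩
  obtain ⟨ρ, hρ, htube⟩ := exists_attracting_tube hα h
  obtain ⟨R, hR⟩ := exists_norm_le_of_isAttractedBy α c γ
  obtain ⟨δ, hδ, C, r, hr0, hr1, hprod⟩ := exists_prod_le_of_multiplicator_neg hα h.2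
  have hbound : ∀ n : ℕ, 1 ≤ R / (ρ / 2) * (C * r ^ n) := by
    intro n
    obtain ⟨f, hf, hfw, hfc, hfd⟩ := exists_inverse_branch h.1 hρ htube hcrit n 0
    have hsub : Metric.closedBall (γ (0 + n • α)) (ρ / 2) ⊆ Metric.ball (γ (0 + n • α)) ρ :=
      Metric.closedBall_subset_ball (by linarith)
    have hd : ‖deriv f (γ (0 + n • α))‖ ≤ R / (ρ / 2) :=
      Complex.norm_deriv_le_of_forall_mem_sphere_norm_le (by positivity)
        (hf.diffContOnCl_ball hsub)
        (fun w hw => hR _ (hfw w (hsub (Metric.sphere_subset_closedBall hw))))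
    have hp : ‖∏ k ∈ Finset.range n, (2 * γ (0 + k • α))‖ ≤ C * r ^ n := by
      rw [norm_prod]
      refine (Finset.prod_le_prod (fun _ _ => norm_nonneg _) fun k _ => ?_).trans (hprod n 0)
      rw [norm_mul]
      simpa using hδ.le
    have := congrArg norm hfd
    rw [norm_mul, norm_one] at this
    rw [← this]
    gcongr
    exact (norm_nonneg _).trans hd
  have hlim : Tendsto (fun n : ℕ => R / (ρ / 2) * (C * r ^ n)) atTop (𝓝 0) := by
    simpa using ((tendsto_pow_atTop_nhds_zero_of_lt_one hr0 hr1).const_mul C).const_mul (R / (ρ / 2))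
  exact absurd (ge_of_tendsto' hlim hbound) (by norm_num)

/-! ### Two disjoint attracting curves. -/

theorem disjoint_criticalBasin {α : UnitAddCircle} {c γ₁ γ₂ : C(UnitAddCircle, ℂ)}
    (hne : ∀ θ, γ₁ θ ≠ γ₂ θ) : Disjoint (criticalBasin α c γ₁) (criticalBasin α c γ₂) := by
  rw [Set.disjoint_left]
  intro θ h1 h2
  -- By compactness the curves are a positive distance apart, so no orbit approaches both.
  obtain ⟨t, -, ht⟩ := isCompact_univ.exists_isMinOn (Set.univ_nonempty (α := UnitAddCircle))
    (f := fun t => dist (γ₁ t) (γ₂ t)) (by fun_prop)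
  have hlim := Tendsto.add h1 h2
  rw [add_zero] at hlim
  obtain ⟨n, hn⟩ := (Tendsto.eventually_lt_const (dist_pos.2 (hne t)) hlim).exists
  refine absurd hn (not_lt.2 ((ht (Set.mem_univ ((fibredQuad α c)^[n] (θ, 0)).1)).trans ?_))
  exact dist_triangle_left _ _ _

theorem nonempty_diff_criticalBasin {α : UnitAddCircle} (hα : ∀ n : ℤ, n ≠ 0 → n • α ≠ 0)
    {c γ₁ γ₂ : C(UnitAddCircle, ℂ)} (h₁ : IsAttractingCurve α c γ₁)
    (h₂ : IsAttractingCurve α c γ₂) (hne : ∀ θ, γ₁ θ ≠ γ₂ θ) :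
    (Set.univ \ (criticalBasin α c γ₁ ∪ criticalBasin α c γ₂)).Nonempty := by
  rw [Set.sdiff_nonempty]
  intro hsub
  have hpre : IsPreconnected (Set.univ : Set UnitAddCircle) := isPreconnected_univ
  obtain ⟨θ, -, hθ⟩ := hpre _ _ (isOpen_criticalBasin hα h₁) (isOpen_criticalBasin hα h₂) hsub
    (by simpa using criticalBasin_nonempty hα h₁) (by simpa using criticalBasin_nonempty hα h₂)
  exact Set.disjoint_left.1 (disjoint_criticalBasin hne) hθ.1 hθ.2

/-! ### Construction of the example. -/

theorem toCircle_add_half (t : UnitAddCircle) :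
    (AddCircle.toCircle (t + ((1 / 2 : ℝ) : UnitAddCircle)) : ℂ) = -AddCircle.toCircle t := by
  have h := fourier_add_half_inv_index (T := 1) one_ne_zero one_pos t
  simpa [fourier_one] using! h

/-- The twisted cohomological equation `2 a(t) - a(t + β) = b(t)` is solvable over any rotation. -/
theorem exists_two_mul_sub_comp_add_eq (β : UnitAddCircle) (b : C(UnitAddCircle, ℂ)) :
    ∃ a : C(UnitAddCircle, ℂ), (∀ t, 2 * a t - a (t + β) = b t) ∧
      ∀ s, (∀ t, b (t + s) = b t) → ∀ t, a (t + s) = a t := by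
  have hu : Summable fun k : ℕ => (1 / 2 : ℝ) ^ (k + 1) * ‖b‖ :=
    ((summable_nat_add_iff 1).2 summable_geometric_two).mul_right _
  have hle : ∀ (k : ℕ) (t : UnitAddCircle),
      ‖(1 / 2 : ℂ) ^ (k + 1) * b (t + k • β)‖ ≤ (1 / 2 : ℝ) ^ (k + 1) * ‖b‖ := fun k t => by
    rw [norm_mul, norm_pow, norm_div, norm_one, Complex.norm_ofNat]
    exact mul_le_mul_of_nonneg_left (b.norm_coe_le_norm _) (by positivity)
  have hsum : ∀ t, Summable fun k : ℕ => (1 / 2 : ℂ) ^ (k + 1) * b (t + k • β) := fun t =>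
    Summable.of_norm_bounded hu fun k => hle k t
  -- Iterating `a = (b + a(· + β)) / 2` gives this series; the factor `1 / 2` removes small
  -- divisors.
  have hcont : Continuous fun t => ∑' k : ℕ, (1 / 2 : ℂ) ^ (k + 1) * b (t + k • β) :=
    continuous_tsum (fun k => by fun_prop) hu hle
  refine ⟨⟨_, hcont⟩, fun t => ?_, fun s hs t => ?_⟩
  · simp only [ContinuousMap.coe_mk]
    rw [(hsum t).tsum_eq_zero_add]
    have : ∀ k : ℕ, (1 / 2 : ℂ) ^ (k + 1 + 1) * b (t + (k + 1) • β) =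
        1 / 2 * ((1 / 2 : ℂ) ^ (k + 1) * b (t + β + k • β)) := fun k => by
      rw [succ_nsmul', ← add_assoc]
      ring
    simp only [this, tsum_mul_left]
    simp
    ring
  · simp only [ContinuousMap.coe_mk]
    refine tsum_congr fun k => ?_
    rw [add_right_comm, hs]

theorem re_toCircle_sq_add_im_toCircle_sq (t : UnitAddCircle) :
    (AddCircle.toCircle t : ℂ).re ^ 2 + (AddCircle.toCircle t : ℂ).im ^ 2 = 1 := by
  have h := Complex.normSq_apply (AddCircle.toCircle t : ℂ)
  rw [Circle.normSq_coe] at h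
  linarith

/-- A loop with odd winding number in the unit disc which avoids `0`. -/
def oddLoop (t : UnitAddCircle) : ℂ :=
  (3 / 4 * (AddCircle.toCircle t : ℂ).re : ℝ) + (1 / 4 * (AddCircle.toCircle t : ℂ).im : ℝ) *
    Complex.I

theorem oddLoop_re (t : UnitAddCircle) : (oddLoop t).re = 3 / 4 * (AddCircle.toCircle t : ℂ).re := by
  simp [oddLoop]

theorem oddLoop_im (t : UnitAddCircle) : (oddLoop t).im = 1 / 4 * (AddCircle.toCircle t : ℂ).im := by
  simp [oddLoop]

theorem continuous_oddLoop : Continuous oddLoop := by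
  have := AddCircle.continuous_toCircle (T := 1)
  unfold oddLoop
  fun_prop

theorem oddLoop_add_half (t : UnitAddCircle) :
    oddLoop (t + ((1 / 2 : ℝ) : UnitAddCircle)) = -oddLoop t := by
  apply Complex.ext
  · rw [Complex.neg_re, oddLoop_re, oddLoop_re, toCircle_add_half, Complex.neg_re]; ring
  · rw [Complex.neg_im, oddLoop_im, oddLoop_im, toCircle_add_half, Complex.neg_im]; ring

/-- The quotient `oddLoop / toCircle` stays in the right half-plane, so the principal logarithm is
continuous on it; the half turn changes both signs. -/
theorem exists_toCircle_mul_exp_eq_oddLoop {z : ℂ} (hz : z ≠ 0) :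
    ∃ b : C(UnitAddCircle, ℂ), (∀ t, z * AddCircle.toCircle t * Complex.exp (b t) = oddLoop t) ∧
      ∀ t, b (t + ((1 / 2 : ℝ) : UnitAddCircle)) = b t := by
  have hre : ∀ t, 0 < (oddLoop t * (starRingEnd ℂ) (AddCircle.toCircle t)).re := fun t => by
    have := re_toCircle_sq_add_im_toCircle_sq t
    rw [Complex.mul_re, oddLoop_re, oddLoop_im, Complex.conj_re, Complex.conj_im]
    nlinarith [sq_nonneg (AddCircle.toCircle t : ℂ).re, sq_nonneg (AddCircle.toCircle t : ℂ).im]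
  have hcont : Continuous fun t : UnitAddCircle =>
      Complex.log (oddLoop t * (starRingEnd ℂ) (AddCircle.toCircle t)) - Complex.log z := by
    have h1 := AddCircle.continuous_toCircle (T := 1)
    have h2 := continuous_oddLoop
    refine Continuous.sub (Continuous.clog ?_ fun t => Or.inl (hre t)) continuous_const
    exact h2.mul (Complex.continuous_conj.comp (continuous_subtype_val.comp h1))
  refine ⟨⟨_, hcont⟩, fun t => ?_, fun t => ?_⟩
  · simp only [ContinuousMap.coe_mk]
    have hne : oddLoop t * (starRingEnd ℂ) (AddCircle.toCircle t) ≠ 0 := fun h => by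
      have := hre t
      rw [h] at this
      exact lt_irrefl _ this
    rw [Complex.exp_sub, Complex.exp_log hne, Complex.exp_log hz]
    have hmul : (AddCircle.toCircle t : ℂ) * (starRingEnd ℂ) (AddCircle.toCircle t) = 1 := by
      rw [Complex.mul_conj, Circle.normSq_coe, Complex.ofReal_one]
    rw [mul_assoc, mul_div_assoc', mul_div_cancel₀ _ hz, mul_left_comm, hmul, mul_one]
  · simp only [ContinuousMap.coe_mk, toCircle_add_half, oddLoop_add_half, map_neg, neg_mul_neg]

theorem one_add_oddLoop_ne_zero (t : UnitAddCircle) : 1 + oddLoop t ≠ 0 := by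
  intro h
  have h1 := congrArg Complex.re h
  rw [Complex.add_re, oddLoop_re] at h1
  simp only [Complex.one_re, Complex.zero_re] at h1
  have := re_toCircle_sq_add_im_toCircle_sq t
  nlinarith [sq_nonneg (AddCircle.toCircle t : ℂ).im]

theorem continuous_log_norm_one_add_oddLoop :
    Continuous fun t => Real.log ‖1 + oddLoop t‖ :=
  continuous_log_of_pos (continuous_const.add continuous_oddLoop).norm
    fun t => norm_pos_iff.2 (one_add_oddLoop_ne_zero t)

/-- Pairing `t` with its half turn gives `log ‖1 - L²‖`. As `L` is the ellipse `Y / 2 + conj Y / 4`,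
with `Y = toCircle`, `L²` has mean `1 / 4`, which drives the negative constant; the `fourier 2` term
integrates to `0`. -/
theorem log_norm_one_add_oddLoop_add_le (t : UnitAddCircle) :
    Real.log ‖1 + oddLoop t‖ + Real.log ‖1 + oddLoop (t + ((1 / 2 : ℝ) : UnitAddCircle))‖ ≤
      -1 / 10 - 15 / 64 * (fourier 2 t : ℂ).re := by
  have h1 := one_add_oddLoop_ne_zero t
  have h2 := one_add_oddLoop_ne_zero (t + ((1 / 2 : ℝ) : UnitAddCircle))
  have huv := re_toCircle_sq_add_im_toCircle_sq t
  rw [← Real.log_mul (norm_ne_zero_iff.2 h1) (norm_ne_zero_iff.2 h2), ← norm_mul]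
  have hpos := norm_pos_iff.2 (mul_ne_zero h1 h2)
  -- Using `log x ≤ x - 1` at the squared norm keeps the estimate polynomial.
  have h3 := Real.log_le_sub_one_of_pos (pow_pos hpos 2)
  rw [Real.log_pow, ← Complex.normSq_eq_norm_sq, Complex.normSq_apply] at h3
  have h4 : (fourier 2 t : ℂ).re = (AddCircle.toCircle t : ℂ).re ^ 2 -
      (AddCircle.toCircle t : ℂ).im ^ 2 := by
    rw [show (2 : ℤ) = 1 + 1 by norm_num, fourier_add, fourier_one, Complex.mul_re]
    ring
  rw [h4]
  rw [oddLoop_add_half] at h3 ⊢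
  simp only [Complex.mul_re, Complex.mul_im, Complex.add_re, Complex.add_im, Complex.neg_re,
    Complex.neg_im, Complex.one_re, Complex.one_im, oddLoop_re, oddLoop_im] at h3
  set u := (AddCircle.toCircle t : ℂ).re
  set v := (AddCircle.toCircle t : ℂ).im
  have hv : v ^ 2 = 1 - u ^ 2 := by linarith
  -- With `v² = 1 - u²` this reads `u⁴ ≤ u²`, which makes the bound linear in `u²`, with the slope
  -- of the right-hand side.
  have hu : 0 ≤ u ^ 2 * v ^ 2 := by positivity
  have h5 : ((1 + 3 / 4 * u) * (1 + -(3 / 4 * u)) - (0 + 1 / 4 * v) * (0 + -(1 / 4 * v))) *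
      ((1 + 3 / 4 * u) * (1 + -(3 / 4 * u)) - (0 + 1 / 4 * v) * (0 + -(1 / 4 * v))) +
      ((1 + 3 / 4 * u) * (0 + -(1 / 4 * v)) + (0 + 1 / 4 * v) * (1 + -(3 / 4 * u))) *
      ((1 + 3 / 4 * u) * (0 + -(1 / 4 * v)) + (0 + 1 / 4 * v) * (1 + -(3 / 4 * u))) =
      (1 - 9 / 16 * u ^ 2 + 1 / 16 * v ^ 2) ^ 2 + 9 / 64 * u ^ 2 * v ^ 2 := by ring
  rw [h5, hv] at h3
  rw [hv] at hu
  rw [hv]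
  push_cast at h3
  nlinarith

theorem integral_log_norm_one_add_oddLoop_neg : ∫ t, Real.log ‖1 + oddLoop t‖ < 0 := by
  have hint := integrable_of_continuous continuous_log_norm_one_add_oddLoop
  have hint' := hint.comp_add_right ((1 / 2 : ℝ) : UnitAddCircle)
  have hre : Integrable fun t : UnitAddCircle => (fourier 2 t : ℂ).re :=
    integrable_of_continuous (Complex.continuous_re.comp (map_continuous (fourier 2)))
  have h0 : ∫ t : UnitAddCircle, (fourier 2 t : ℂ).re = 0 := by
    have := integral_re (𝕜 := ℂ) (fourier (T := 1) 2).integrable_unitAddCircle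
    rw [integral_fourier_eq_zero two_ne_zero] at this
    simpa using! this
  have hle := integral_mono (hint.add hint') ((integrable_const (-1 / 10 : ℝ)).sub
    (hre.const_mul (15 / 64))) log_norm_one_add_oddLoop_add_le
  have h1 := integral_add hint hint'
  have h2 := integral_sub (integrable_const (-1 / 10 : ℝ)) (hre.const_mul (15 / 64))
  rw [integral_const_mul, h0] at h2
  rw [integral_add_right_eq_self (fun t => Real.log ‖1 + oddLoop t‖)
    ((1 / 2 : ℝ) : UnitAddCircle)] at h1
  have h3 := (h1.symm.trans_le hle).trans_eq h2
  simp [measureReal_def] at h3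
  linarith

theorem exists_two_attracting_curves (β : UnitAddCircle) :
    ∃ c γ₁ γ₂ : C(UnitAddCircle, ℂ),
      (∀ t, c (t + ((1 / 2 : ℝ) : UnitAddCircle)) = c t) ∧
      (∀ t, γ₂ t = γ₁ (t + ((1 / 2 : ℝ) : UnitAddCircle))) ∧
      (∀ t, γ₁ t ≠ γ₂ t) ∧ IsAttractingCurve β c γ₁ ∧ IsAttractingCurve β c γ₂ ∧
      ⊥ < multiplicator c γ₁ ∧ ⊥ < multiplicator c γ₂ := by
  set h : UnitAddCircle := ((1 / 2 : ℝ) : UnitAddCircle)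
  have hY : ∀ t : UnitAddCircle, (AddCircle.toCircle t : ℂ) ≠ 0 := fun t => Circle.coe_ne_zero _
  -- Substituting `o = toCircle * exp a` into `2 o² = oddLoop * o(· + β)` leaves the constant `2 /
  -- toCircle β` and the equation `2 a - a(· + β) = b`.
  obtain ⟨b, hb, hbh⟩ := exists_toCircle_mul_exp_eq_oddLoop
    (z := 2 / AddCircle.toCircle β) (div_ne_zero two_ne_zero (hY β))
  obtain ⟨a, ha, hah⟩ := exists_two_mul_sub_comp_add_eq β b
  replace hah := hah h hbh
  have hYc : Continuous fun t : UnitAddCircle => (AddCircle.toCircle t : ℂ) :=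
    continuous_subtype_val.comp AddCircle.continuous_toCircle
  set o : UnitAddCircle → ℂ := fun t => AddCircle.toCircle t * Complex.exp (a t) with ho
  have hoc : Continuous o := by fun_prop
  have hne : ∀ t, o t ≠ 0 := fun t => mul_ne_zero (hY t) (Complex.exp_ne_zero _)
  have hoh : ∀ t, o (t + h) = -o t := fun t => by
    simp only [ho]
    rw [toCircle_add_half, hah]
    ring
  have hloop : ∀ t, 2 * o t ^ 2 = oddLoop t * o (t + β) := fun t => by
    have h1 := hY β
    rw [← hb]
    simp only [ho]
    rw [AddCircle.toCircle_add, Circle.coe_mul, ← ha, Complex.exp_sub, two_mul (a t),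
      Complex.exp_add]
    have h2 := Complex.exp_ne_zero (a (t + β))
    field_simp
  have hnorm : ∀ t, ‖o t‖ = Real.exp (a t).re := fun t => by
    simp only [ho]
    rw [norm_mul, Circle.norm_coe, one_mul, Complex.norm_exp]
  set e : UnitAddCircle → ℂ := fun t => o (t + β) / (2 * o t) with he
  have hec : Continuous e :=
    (hoc.comp (continuous_add_const β)).div (by fun_prop) fun t =>
      mul_ne_zero two_ne_zero (hne t)
  have heh : ∀ t, e (t + h) = e t := fun t => by
    simp only [he]
    rw [add_right_comm, hoh, hoh, mul_neg, neg_div_neg_eq]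
  have heo : ∀ t, 2 * e t * o t = o (t + β) := fun t => by
    simp only [he]
    have := hne t
    field_simp
  set γ₁ : C(UnitAddCircle, ℂ) := ⟨fun t => e t + o t, hec.add hoc⟩
  set γ₂ : C(UnitAddCircle, ℂ) := γ₁.comp ⟨fun t => t + h, continuous_add_const h⟩
  have hγ₁' : ∀ t, γ₁ t = e t + o t := fun t => rfl
  have hγ₂' : ∀ t, γ₂ t = γ₁ (t + h) := fun t => rfl
  set c : C(UnitAddCircle, ℂ) := ⟨fun t => γ₁ (t + β) - γ₁ t ^ 2, by fun_prop⟩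
  have hc' : ∀ t, c t = γ₁ (t + β) - γ₁ t ^ 2 := fun t => rfl
  have hch : ∀ t, c (t + h) = c t := fun t => by
    rw [hc', hc', add_right_comm]
    simp only [hγ₁', heh, hoh]
    linear_combination 2 * heo t
  have hinv₁ : IsInvariantCurve β c γ₁ := fun t => by
    simp [fibredQuad, fibrePoly, hc']
  have hinv₂ : IsInvariantCurve β c γ₂ := fun t => by
    simp only [fibredQuad, fibrePoly, hγ₂', ← hch t, hc' (t + h)]
    rw [add_right_comm t h β, add_sub_cancel]
  have hprod : ∀ t, 2 * γ₁ t * o t = o (t + β) * (1 + oddLoop t) := fun t => by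
    rw [hγ₁']
    linear_combination heo t + hloop t
  have hγ₁0 : ∀ t, γ₁ t ≠ 0 := fun t h0 => by
    have h1 := hprod t
    rw [h0, mul_zero, zero_mul] at h1
    exact mul_ne_zero (hne _) (one_add_oddLoop_ne_zero t) h1.symm
  -- The factor `o(· + β) / o` contributes only a coboundary, of integral `0`.
  have hlog : ∀ t, Real.log (2 * ‖γ₁ t‖) =
      (a (t + β)).re - (a t).re + Real.log ‖1 + oddLoop t‖ := fun t => by
    have h1 := congrArg (fun z : ℂ => Real.log ‖z‖) (hprod t)
    simp only [norm_mul, hnorm, Complex.norm_ofNat] at h1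
    rw [Real.log_mul (mul_ne_zero two_ne_zero (norm_ne_zero_iff.2 (hγ₁0 t))) (Real.exp_ne_zero _),
      Real.log_mul (Real.exp_ne_zero _) (norm_ne_zero_iff.2 (one_add_oddLoop_ne_zero t)),
      Real.log_exp, Real.log_exp] at h1
    linarith
  have hint : ∫ t, Real.log (2 * ‖γ₁ t‖) = ∫ t, Real.log ‖1 + oddLoop t‖ := by
    have hre : Integrable fun t => (a t).re := integrable_of_continuous (by fun_prop)
    have hre' : Integrable fun t => (a (t + β)).re := integrable_of_continuous (by fun_prop)
    have hsub : Integrable fun t => (a (t + β)).re - (a t).re := hre'.sub hre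
    simp only [hlog]
    rw [integral_add hsub
      (integrable_of_continuous continuous_log_norm_one_add_oddLoop), integral_sub hre' hre,
      integral_add_right_eq_self (fun t => (a t).re) β, sub_self, zero_add]
  have hm₁ : multiplicator c γ₁ = ((∫ t, Real.log ‖1 + oddLoop t‖ : ℝ) : EReal) := by
    rw [multiplicator_eq_integral c γ₁ hγ₁0, hint]
  have hm₂ : multiplicator c γ₂ = ((∫ t, Real.log ‖1 + oddLoop t‖ : ℝ) : EReal) := by
    rw [multiplicator_eq_integral c γ₂ fun t => hγ₁0 _, ← hint]
    simp only [hγ₂']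
    rw [integral_add_right_eq_self (fun t => Real.log (2 * ‖γ₁ t‖)) h]
  have hneg : ((∫ t, Real.log ‖1 + oddLoop t‖ : ℝ) : EReal) < 0 := by
    exact_mod_cast integral_log_norm_one_add_oddLoop_neg
  refine ⟨c, γ₁, γ₂, hch, hγ₂', fun t hEq => ?_, ⟨hinv₁, hm₁ ▸ hneg⟩, ⟨hinv₂, hm₂ ▸ hneg⟩,
    hm₁ ▸ EReal.bot_lt_coe _, hm₂ ▸ EReal.bot_lt_coe _⟩
  rw [hγ₂', hγ₁', hγ₁', heh, hoh] at hEq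
  have : 2 * o t = 0 := by linear_combination hEq
  exact hne t (by simpa using this)

end

theorem mainTheorem3 :
    -- for every attracting invariant curve the set of attracted critical points is open, non-empty
    (∀ (α : ℝ), Irrational α → ∀ (c η : C(UnitAddCircle, ℂ)),
      IsAttractingCurve (α : UnitAddCircle) c η →
        IsOpen (criticalBasin (α : UnitAddCircle) c η) ∧
        (criticalBasin (α : UnitAddCircle) c η).Nonempty) ∧
    -- if there are two disjoint such curves, some critical point is attracted by neither of them
    (∀ (α : ℝ), Irrational α → ∀ (c γ₁ γ₂ : C(UnitAddCircle, ℂ)),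
      IsAttractingCurve (α : UnitAddCircle) c γ₁ →
      IsAttractingCurve (α : UnitAddCircle) c γ₂ →
      (∀ θ, γ₁ θ ≠ γ₂ θ) →
        Disjoint (criticalBasin (α : UnitAddCircle) c γ₁)
          (criticalBasin (α : UnitAddCircle) c γ₂) ∧
        (Set.univ \ (criticalBasin (α : UnitAddCircle) c γ₁ ∪
          criticalBasin (α : UnitAddCircle) c γ₂)).Nonempty) ∧
    -- an example with two disjoint attracting invariant curves, with the symmetry of a 2-unfolding
    (∃ (α : ℝ) (c γ₁ γ₂ : C(UnitAddCircle, ℂ)), Irrational α ∧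
      (∀ t, c (t + ((1 / 2 : ℝ) : UnitAddCircle)) = c t) ∧
      (∀ t, γ₂ t = γ₁ (t + ((1 / 2 : ℝ) : UnitAddCircle))) ∧
      (∀ t, γ₁ t ≠ γ₂ t) ∧
      IsAttractingCurve (((α + 1) / 2 : ℝ) : UnitAddCircle) c γ₁ ∧
      IsAttractingCurve (((α + 1) / 2 : ℝ) : UnitAddCircle) c γ₂ ∧
      ⊥ < multiplicator c γ₁ ∧ ⊥ < multiplicator c γ₂) := by
  refine ⟨fun α hα c η h => ?_, fun α hα c γ₁ γ₂ h₁ h₂ hne => ?_, ?_⟩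
  · have hα' := fun (n : ℤ) (hn : n ≠ 0) => zsmul_coe_ne_zero_of_irrational hα hn
    exact ⟨isOpen_criticalBasin hα' h, criticalBasin_nonempty hα' h⟩
  · exact ⟨disjoint_criticalBasin hne, nonempty_diff_criticalBasin
      (fun n hn => zsmul_coe_ne_zero_of_irrational hα hn) h₁ h₂ hne⟩
  · obtain ⟨c, γ₁, γ₂, h⟩ := exists_two_attracting_curves (((√2 + 1) / 2 : ℝ) : UnitAddCircle)
    exact ⟨√2, c, γ₁, γ₂, irrational_sqrt_two, h⟩
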